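/- Let $n\ge 1$ and $a\ge 1$ be integers, let $\mathbf a=(a,1,\dots,1)\in\mathbb R^{n+1}$ be the vector with $n$ ones, and let $x\in\mathbb C$ with $\operatorname{Re}x>0$. Let $$\zeta(s;x,\mathbf a)=\sum_{(m_0,\dots,m_n)\in\mathbb Z_{\ge 0}^{n+1}}\frac{1}{(x+m_0a+m_1+\dots+m_n)^{s}}\qquad(\operatorname{Re}s>n+1)$$ be the Barnes zeta function and, for $\operatorname{Re}y>0$, let $\zeta(s;y)=\sum_{m\ge0}(y+m)^{-s}$ $(\operatorname{Re}s>1)$ be the Hurwitz zeta function (powers are taken with the principal branch). Let the Bernoulli–Barnes polynomials $B_k(x;\mathbf a)$ be defined by $$\frac{z^{n+1}e^{xz}}{(e^{az}-1)(e^z-1)^n}=\sum_{k\ge0}B_k(x;\mathbf a)\frac{z^k}{k!}.$$ Then both series converge absolutely in the stated half-planes, both zeta functions continue meromorphically in $s$ to $\mathbb C$, and, as an identity of meromorphic functions of $s$, valid at every $s\in\mathbb C\setminus\{1,\dots,n+1\}$, $$\zeta(s;x,\mathbf a)=\frac{(-1)^{n}}{n!}\sum_{k=0}^{n}(-1)^k\binom{n}{k}B_{n-k}(x;\mathbf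 a)\,\zeta(s-k;x)+\frac{(-1)^{n-1}}{n!}\,a^{-s}\sum_{r=1}^{a}B_n(r;\mathbf a)\,\zeta\!\left(s;1+\frac{x-r}{a}\right).$$ -/

import Mathlib

namespace BarnesZeta

noncomputable section

/-- `F` is the meromorphic continuation to the whole complex plane of the function `f` given on the
half-plane `Re s > σ`. "Normal form" fixes the values of a meromorphic function at single points: `F`
is analytic at every point that is not a pole (removable singularities are filled in), and `F` is `0`
at its poles. -/
def IsMeromorphicContinuation (σ : ℝ) (f F : ℂ → ℂ) : Prop :=
  MeromorphicNFOn F Set.univ ∧ ∀ s : ℂ, σ < s.re → F s = f s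

/-- A meromorphic continuation is unique. -/
theorem IsMeromorphicContinuation.unique {σ : ℝ} {f F G : ℂ → ℂ}
    (hF : IsMeromorphicContinuation σ f F) (hG : IsMeromorphicContinuation σ f G) : F = G := by
  have hF' : MeromorphicOn F Set.univ := fun z hz => (hF.1 hz).meromorphicAt
  have hG' : MeromorphicOn G Set.univ := fun z hz => (hG.1 hz).meromorphicAt
  have hz : meromorphicOrderAt (F - G) ((σ + 1 : ℝ) : ℂ) = ⊤ := by
    rw [meromorphicOrderAt_eq_top_iff]
    refine Filter.Eventually.filter_mono nhdsWithin_le_nhds ?_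
    have hop : IsOpen {s : ℂ | σ < s.re} := isOpen_lt continuous_const Complex.continuous_re
    filter_upwards [hop.mem_nhds (show σ < ((σ + 1 : ℝ) : ℂ).re by simp)] with s hs
    simp [hF.2 s hs, hG.2 s hs]
  funext w
  have hw : meromorphicOrderAt (F - G) w = ⊤ := by
    by_contra h
    exact (hF'.sub hG').meromorphicOrderAt_ne_top_of_isPreconnected isPreconnected_univ
      (Set.mem_univ w) (Set.mem_univ _) h hz
  rw [meromorphicOrderAt_eq_top_iff] at hw
  have he : F =ᶠ[nhdsWithin w {w}ᶜ] G := by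
    filter_upwards [hw] with s hs
    exact sub_eq_zero.mp hs
  exact (((hF.1 (Set.mem_univ w)).eventuallyEq_nhdsNE_iff_eventuallyEq_nhds
    (hG.1 (Set.mem_univ w))).1 he).eq_of_nhds

open Classical in
/-- The meromorphic continuation to `ℂ` of `f` on `Re s > σ` (the zero function if there is none). -/
def meromorphicContinuation (σ : ℝ) (f : ℂ → ℂ) : ℂ → ℂ :=
  if h : ∃ F, IsMeromorphicContinuation σ f F then h.choose else 0

/-- The term `(x + m₁ a₁ + ⋯ + mₙ aₙ) ^ (-s)` of the Barnes series (principal branch). -/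
def barnesTerm {n : ℕ} (a : Fin n → ℝ) (x s : ℂ) (m : Fin n → ℕ) : ℂ :=
  1 / (x + ∑ i, (m i : ℂ) * (a i : ℂ)) ^ s

/-- The Barnes zeta function `s ↦ ζ(s; x, a)`, for `a` with positive entries and `Re x > 0`: the
meromorphic continuation of the Barnes series, which converges for `Re s > n`. -/
def barnesZeta {n : ℕ} (a : Fin n → ℝ) (x : ℂ) : ℂ → ℂ :=
  meromorphicContinuation n fun s => ∑' m : Fin n → ℕ, barnesTerm a x s m

/-- The term `(x + m) ^ (-s)` of the Hurwitz series (principal branch). -/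
def hurwitzTerm (x s : ℂ) (m : ℕ) : ℂ :=
  1 / (x + m) ^ s

/-- The Hurwitz zeta function `s ↦ ζ(s; x)`, for a complex parameter with `Re x > 0`: the
meromorphic continuation of the Hurwitz series, which converges for `Re s > 1`. -/
def hurwitzZeta (x : ℂ) : ℂ → ℂ :=
  meromorphicContinuation 1 fun s => ∑' m : ℕ, hurwitzTerm x s m

open PowerSeries in
/-- The power series `(e ^ (c z) - 1) / z` in `z`. -/
def expSubOneDivX (c : ℂ) : PowerSeries ℂ :=
  PowerSeries.mk fun k => coeff (k + 1) (rescale c (exp ℂ) - 1)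

open PowerSeries in
theorem X_mul_expSubOneDivX (c : ℂ) : X * expSubOneDivX c = rescale c (exp ℂ) - 1 := by
  ext k
  cases k with
  | zero =>
    rw [coeff_zero_X_mul, map_sub, coeff_rescale, coeff_exp, coeff_one]
    simp
  | succ k => rw [coeff_succ_X_mul, expSubOneDivX, coeff_mk]

open PowerSeries in
/-- The power series `z ^ n e ^ (x z) / ((e ^ (a₁ z) - 1) ⋯ (e ^ (aₙ z) - 1))` in `z`. -/
def bernoulliBarnesSeries {n : ℕ} (a : Fin n → ℝ) (x : ℂ) : PowerSeries ℂ :=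
  rescale x (exp ℂ) * ∏ i, (expSubOneDivX (a i : ℂ))⁻¹

open PowerSeries in
theorem bernoulliBarnesSeries_mul {n : ℕ} (a : Fin n → ℝ) (ha : ∀ i, a i ≠ 0) (x : ℂ) :
    bernoulliBarnesSeries a x * ∏ i, (rescale (a i : ℂ) (exp ℂ) - 1)
      = X ^ n * rescale x (exp ℂ) := by
  have h : ∀ i, (expSubOneDivX (a i : ℂ))⁻¹ * (rescale (a i : ℂ) (exp ℂ) - 1) = X := by
    intro i
    have h0 : constantCoeff (expSubOneDivX (a i : ℂ)) ≠ 0 := by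
      rw [← coeff_zero_eq_constantCoeff_apply, expSubOneDivX, coeff_mk]
      simpa [coeff_rescale, coeff_exp, coeff_one] using ha i
    rw [← X_mul_expSubOneDivX, mul_left_comm, PowerSeries.inv_mul_cancel _ h0, mul_one]
  rw [bernoulliBarnesSeries, mul_assoc, ← Finset.prod_mul_distrib, Finset.prod_congr rfl fun i _ => h i]
  simp [mul_comm]

/-- The Bernoulli–Barnes polynomial `B_k(x; a)`, defined by
`z ^ n e ^ (x z) / ((e ^ (a₁ z) - 1) ⋯ (e ^ (aₙ z) - 1)) = ∑ₖ B_k(x; a) z ^ k / k!`. -/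
def bernoulliBarnes {n : ℕ} (k : ℕ) (x : ℂ) (a : Fin n → ℝ) : ℂ :=
  (k.factorial : ℂ) * PowerSeries.coeff k (bernoulliBarnesSeries a x)

/-- The vector `(a, 1, …, 1)` with `n` ones. -/
def consOnes (a n : ℕ) : Fin (n + 1) → ℝ :=
  Fin.cons (a : ℝ) fun _ => 1

end

end BarnesZeta

/-! Grouping the Barnes series by the value $N=am_0+m_1+\dots+m_n$ turns it into $\sum_N
c_N(x+N)^{-s}$, where $c_N$ counts the solutions. For fixed $m_0=j$, stars and bars gives
$\binom{N-aj+n-1}{n-1}$. Up to sign and $n!$, this is the difference of $B_n(\cdot;\mathbf a)$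
between $-N+aj$ and $-N+a(j+1)$, so the sum over $j$ telescopes (`card_fiber_consOnes_eq`):
$$c_N=\frac{(-1)^n}{n!}\bigl(B_n(-N;\mathbf a)-B_n(a-N\bmod a;\mathbf a)\bigr).$$ Expanding
$B_n(-N)=B_n(x-(x+N))$ in powers of $x+N$ gives the shifted functions $\zeta(s-k;x)$. The other term
depends only on $N$ modulo $a$; splitting into residue classes gives $a^{-s}\zeta(s;1+(x-r)/a)$.
This proves the identity for $\operatorname{Re}s>n+1$ (`summable_and_tsum_barnesTerm`).

The Hurwitz function is continued through its Mellin integral: removing $K$ Taylor terms at $t=0$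
from the kernel moves the half-plane of convergence to $\operatorname{Re}s>1-K$, and the removed
terms are explicit (`hurwitzZeta_spec`). The right-hand side then continues the Barnes series, and
uniqueness of continuation gives the identity everywhere. -/

section

open Complex MeasureTheory Set Filter Topology Asymptotics

namespace BarnesZeta

/-! ### The Gamma integral with complex scale -/

/-- `t ^ (a - 1) * exp (-(r t))` is integrable on `(0, ∞)` for `Re a > 0`, `Re r > 0`. -/
theorem integrableOn_cpow_mul_exp_neg_mul {a r : ℂ} (ha : 0 < a.re) (hr : 0 < r.re) :
    IntegrableOn (fun t : ℝ => (t : ℂ) ^ (a - 1) * exp (-(r * t))) (Ioi 0) := by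
  have hc : ContinuousOn (fun t : ℝ => (t : ℂ) ^ (a - 1) * exp (-(r * t))) (Ioi 0) := by
    refine ContinuousOn.mul (fun t ht => ?_) (by fun_prop)
    exact (continuousAt_ofReal_cpow_const _ _ (Or.inr (ne_of_gt ht))).continuousWithinAt
  refine (integrable_norm_iff (hc.aestronglyMeasurable measurableSet_Ioi)).1 ?_
  have h := integrableOn_rpow_mul_exp_neg_mul_rpow (p := 1) (s := a.re - 1) (b := r.re)
    (by linarith) one_pos hr
  refine h.congr_fun (fun t ht => ?_) measurableSet_Ioi
  have ht' : (0 : ℝ) < t := ht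
  simp [norm_cpow_eq_rpow_re_of_pos ht', Complex.norm_exp]

theorem norm_cpow_mul_exp_neg_mul {a r : ℂ} {t : ℝ} (ht : 0 < t) :
    ‖(t : ℂ) ^ (a - 1) * exp (-(r * t))‖ = t ^ (a.re - 1) * Real.exp (-(r.re * t)) := by
  simp [norm_cpow_eq_rpow_re_of_pos ht, Complex.norm_exp]

/-- The Gamma integral with a complex scale. -/
theorem integral_cpow_mul_exp_neg_mul_Ioi_complex {a r : ℂ} (ha : 0 < a.re) (hr : 0 < r.re) :
    ∫ t : ℝ in Ioi 0, (t : ℂ) ^ (a - 1) * exp (-(r * t)) = r ^ (-a) * Gamma a := by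
  have hopen : IsOpen {r : ℂ | 0 < r.re} := isOpen_lt continuous_const continuous_re
  have hL : DifferentiableOn ℂ
      (fun r : ℂ => ∫ t : ℝ in Ioi 0, (t : ℂ) ^ (a - 1) * exp (-(r * t))) {r : ℂ | 0 < r.re} := by
    intro r₀ hr₀
    have hr₀ : 0 < r₀.re := hr₀
    -- On the ball of radius half of `r₀.re` the real part stays above `r₀.re / 2`, so one
    -- integrable function dominates all the derivatives in `r`.
    have hball : ∀ r ∈ Metric.ball r₀ (r₀.re / 2), r₀.re / 2 < r.re := by
      intro r hr
      have := (abs_re_le_norm (r - r₀)).trans_lt (mem_ball_iff_norm.1 hr)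
      rw [sub_re] at this
      linarith [(abs_lt.1 this).1]
    have hd := hasDerivAt_integral_of_dominated_loc_of_deriv_le
      (μ := volume.restrict (Ioi (0 : ℝ)))
      (F := fun (r : ℂ) (t : ℝ) => (t : ℂ) ^ (a - 1) * exp (-(r * t)))
      (F' := fun (r : ℂ) (t : ℝ) => (t : ℂ) ^ (a - 1) * (exp (-(r * t)) * -t))
      (bound := fun t => t ^ a.re * Real.exp (-(r₀.re / 2) * t ^ (1 : ℝ)))
      (x₀ := r₀) (s := Metric.ball r₀ (r₀.re / 2)) (Metric.ball_mem_nhds _ (by linarith))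
      ?_ (integrableOn_cpow_mul_exp_neg_mul ha hr₀) ?_ ?_
      (integrableOn_rpow_mul_exp_neg_mul_rpow (by linarith) one_pos (by linarith)) ?_
    · exact hd.2.differentiableAt.differentiableWithinAt
    · filter_upwards [hopen.mem_nhds hr₀] with r hr
      exact (integrableOn_cpow_mul_exp_neg_mul ha hr).aestronglyMeasurable
    · refine ContinuousOn.aestronglyMeasurable ?_ measurableSet_Ioi
      refine ContinuousOn.mul (fun t ht => ?_) (by fun_prop)
      exact (continuousAt_ofReal_cpow_const _ _ (Or.inr (ne_of_gt ht))).continuousWithinAt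
    · refine (ae_restrict_iff' measurableSet_Ioi).2 (Eventually.of_forall fun t ht r hr => ?_)
      have ht' : (0 : ℝ) < t := ht
      rw [← mul_assoc, norm_mul, norm_cpow_mul_exp_neg_mul ht', norm_neg, norm_real,
        Real.norm_of_nonneg ht'.le, Real.rpow_one, mul_right_comm, Real.rpow_sub_one ht'.ne',
        div_mul_cancel₀ _ ht'.ne']
      gcongr
      nlinarith [hball r hr]
    · refine Eventually.of_forall fun t r _ => ?_
      have h1 : HasDerivAt (fun r : ℂ => -(r * t)) (-(t : ℂ)) r := by
        have h2 := ((hasDerivAt_id r).mul_const (t : ℂ)).neg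
        rw [one_mul] at h2
        exact h2
      exact h1.cexp.const_mul _
  have hR : DifferentiableOn ℂ (fun r : ℂ => r ^ (-a) * Gamma a) {r : ℂ | 0 < r.re} := by
    intro r hr
    exact ((differentiableAt_id.cpow_const (Or.inl hr)).mul_const _).differentiableWithinAt
  have hpre : IsPreconnected {r : ℂ | 0 < r.re} := (convex_halfSpace_re_gt 0).isPreconnected
  -- Identity theorem: the formula is known for positive real scales, which accumulate at `1`.
  refine (hL.analyticOnNhd hopen).eqOn_of_preconnected_of_frequently_eq (hR.analyticOnNhd hopen)
    hpre (z₀ := 1) (by simp) ?_ hr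
  have hto : Tendsto (fun t : ℝ => (t : ℂ)) (𝓝[≠] 1) (𝓝[≠] 1) := by
    rw [tendsto_nhdsWithin_iff]
    refine ⟨?_, ?_⟩
    · exact ((continuous_ofReal.tendsto' 1 1 (by simp))).mono_left nhdsWithin_le_nhds
    · filter_upwards [self_mem_nhdsWithin] with t ht
      simpa using ht
  refine hto.frequently (Eventually.frequently ?_)
  filter_upwards [nhdsWithin_le_nhds (lt_mem_nhds (zero_lt_one (α := ℝ)))] with t ht
  rw [integral_cpow_mul_exp_neg_mul_Ioi ha ht, one_div,
    inv_cpow _ _ (by rw [arg_ofReal_of_nonneg ht.le]; exact Real.pi_pos.ne), cpow_neg]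

/-! ### The Hurwitz series and its Mellin integral -/

/-- A bound for the reciprocal of a complex power by the reciprocal of a real power. -/
theorem norm_one_div_cpow_le {z : ℂ} (hz : z ≠ 0) (s : ℂ) :
    ‖1 / z ^ s‖ ≤ Real.exp (Real.pi * |s.im|) * (‖z‖ ^ s.re)⁻¹ := by
  rw [norm_div, norm_one, norm_cpow_of_ne_zero hz, one_div, inv_div, div_eq_mul_inv]
  have h : z.arg * s.im ≤ Real.pi * |s.im| :=
    calc z.arg * s.im ≤ |z.arg * s.im| := le_abs_self _
      _ = |z.arg| * |s.im| := abs_mul _ _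
      _ ≤ Real.pi * |s.im| := by gcongr; exact abs_arg_le_pi z
  exact mul_le_mul_of_nonneg_right (Real.exp_le_exp.2 h) (by positivity)

theorem add_nat_re_pos {y : ℂ} (hy : 0 < y.re) (m : ℕ) : 0 < (y + m).re := by
  rw [add_re, natCast_re]; positivity

theorem ne_zero_of_zero_lt_re {y : ℂ} (hy : 0 < y.re) : y ≠ 0 := by
  rintro rfl; simp at hy

theorem summable_add_nat_rpow_inv {c p : ℝ} (hc : 0 < c) (hp : 1 < p) :
    Summable fun m : ℕ => ((c + m) ^ p)⁻¹ := by
  refine (summable_nat_add_iff 1).1 ?_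
  have h : Summable fun m : ℕ => (((m + 1 : ℕ) : ℝ) ^ p)⁻¹ :=
    (summable_nat_add_iff (f := fun m : ℕ => ((m : ℝ) ^ p)⁻¹) 1).2 (Real.summable_nat_rpow_inv.2 hp)
  refine h.of_nonneg_of_le (fun m => by positivity) fun m => ?_
  gcongr
  linarith

/-- Absolute convergence of the Hurwitz series. -/
theorem summable_norm_hurwitzTerm {y s : ℂ} (hy : 0 < y.re) (hs : 1 < s.re) :
    Summable fun m => ‖hurwitzTerm y s m‖ := by
  refine ((summable_add_nat_rpow_inv hy hs).mul_left
    (Real.exp (Real.pi * |s.im|))).of_nonneg_of_le (fun m => norm_nonneg _) fun m => ?_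
  refine (norm_one_div_cpow_le (ne_zero_of_zero_lt_re (add_nat_re_pos hy m)) s).trans ?_
  have h1 : y.re + m ≤ ‖y + m‖ := by simpa using re_le_norm (y + m)
  gcongr

/-- The integral representation of the Hurwitz zeta function. -/
theorem hasSum_Gamma_mul_hurwitzTerm {y s : ℂ} (hy : 0 < y.re) (hs : 1 < s.re) :
    HasSum (fun m => Gamma s * hurwitzTerm y s m)
      (mellin (fun t : ℝ => exp (-(y * t)) / (1 - exp (-t))) s) := by
  have hs0 : 0 < s.re := by linarith
  have h := hasSum_integral_of_summable_integral_norm (μ := volume.restrict (Ioi (0 : ℝ)))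
    (F := fun (m : ℕ) (t : ℝ) => (t : ℂ) ^ (s - 1) * exp (-((y + m) * t)))
    (fun m => integrableOn_cpow_mul_exp_neg_mul hs0 (add_nat_re_pos hy m)) ?_
  · have h1 : ∀ m : ℕ, ∫ t : ℝ in Ioi 0, (t : ℂ) ^ (s - 1) * exp (-((y + m) * t))
        = Gamma s * hurwitzTerm y s m := by
      intro m
      rw [integral_cpow_mul_exp_neg_mul_Ioi_complex hs0 (add_nat_re_pos hy m), hurwitzTerm,
        cpow_neg, one_div, mul_comm]
    simp_rw [h1] at h
    suffices hE : mellin (fun t : ℝ => exp (-(y * t)) / (1 - exp (-t))) s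
        = ∫ t : ℝ in Ioi 0, ∑' m : ℕ, (t : ℂ) ^ (s - 1) * exp (-((y + m) * t)) by
      rw [hE]
      exact h
    refine setIntegral_congr_fun measurableSet_Ioi fun t ht => ?_
    have ht' : (0 : ℝ) < t := ht
    have hlt : ‖exp (-(t : ℂ))‖ < 1 := by
      rw [Complex.norm_exp]
      simpa using ht'
    have hg := (hasSum_geometric_of_norm_lt_one hlt).mul_left ((t : ℂ) ^ (s - 1) * exp (-(y * t)))
    rw [smul_eq_mul]
    beta_reduce
    rw [div_eq_mul_inv, ← mul_assoc, ← hg.tsum_eq]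
    congr 1 with m
    rw [← exp_nat_mul, mul_assoc, ← exp_add]
    congr 2
    ring
  · have h2 : ∀ m : ℕ, ∫ t : ℝ in Ioi 0, ‖(t : ℂ) ^ (s - 1) * exp (-((y + m) * t))‖
        = Real.Gamma s.re * ((y.re + m) ^ s.re)⁻¹ := by
      intro m
      have hm : 0 < y.re + m := by simpa using add_nat_re_pos hy m
      rw [setIntegral_congr_fun measurableSet_Ioi fun t ht => norm_cpow_mul_exp_neg_mul ht]
      have := Real.integral_rpow_mul_exp_neg_mul_Ioi hs0 hm
      simp only [add_re, natCast_re]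
      rw [this, one_div, Real.inv_rpow hm.le, mul_comm]
    simp_rw [h2]
    exact (summable_add_nat_rpow_inv hy hs).mul_left _

/-! ### Continuation of the Hurwitz zeta function -/

/-- `z / (1 - exp (-z))` has a Taylor expansion at `0`. -/
theorem exists_isBigO_div_one_sub_exp_sub : ∃ c : ℕ → ℂ, ∀ K : ℕ,
    (fun t : ℝ => (t : ℂ) / (1 - exp (-t)) - ∑ j ∈ Finset.range K, c j * (t : ℂ) ^ j)
      =O[𝓝[>] 0] fun t : ℝ => t ^ K := by
  have hf : AnalyticAt ℂ (fun z : ℂ => 1 - exp (-z)) 0 := by fun_prop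
  obtain ⟨p, hp⟩ := hf
  -- The slope at `0` is `(1 - exp (-z)) / z` with the removable singularity filled by `1`, so its
  -- inverse is analytic at `0`.
  have hd : AnalyticAt ℂ (dslope (fun z : ℂ => 1 - exp (-z)) 0) 0 :=
    ⟨_, hp.has_fpower_series_dslope_fslope⟩
  have hd0 : dslope (fun z : ℂ => 1 - exp (-z)) 0 0 ≠ 0 := by
    have h1 : HasDerivAt (fun z : ℂ => 1 - exp (-z)) 1 0 := by
      simpa using ((hasDerivAt_neg (0 : ℂ)).cexp).const_sub 1
    rw [dslope_same, h1.deriv]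
    exact one_ne_zero
  obtain ⟨q, hq⟩ := hd.inv hd0
  refine ⟨q.coeff, fun K => ?_⟩
  have h := (hq.isBigO_sub_partialSum_pow K).comp_tendsto
    ((continuous_ofReal.tendsto' 0 0 (by simp)).mono_left (nhdsWithin_le_nhds (s := Ioi 0)))
  refine (h.congr' ?_ ?_)
  · filter_upwards [self_mem_nhdsWithin] with t ht
    have ht' : (t : ℂ) ≠ 0 := ofReal_ne_zero.2 (ne_of_gt ht)
    simp only [Function.comp_apply, zero_add, Pi.inv_apply]
    rw [dslope_of_ne _ ht', slope_def_field, FormalMultilinearSeries.partialSum]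
    simp [mul_comm]
  · filter_upwards [self_mem_nhdsWithin] with t ht
    have ht' : (0 : ℝ) < t := ht
    rw [Function.comp_apply, norm_real, Real.norm_of_nonneg ht'.le]

/-- The Mellin kernel of the Hurwitz zeta function with `K` terms of its expansion at `0` taken
off. -/
noncomputable def hurwitzKernel (c : ℕ → ℂ) (y : ℂ) (K : ℕ) (t : ℝ) : ℂ :=
  exp (-(y * t)) * ((1 - exp (-t))⁻¹ - ∑ j ∈ Finset.range K, c j * ((t : ℂ) ^ j / t))

theorem one_sub_exp_neg_ne_zero {t : ℝ} (ht : 0 < t) : 1 - exp (-(t : ℂ)) ≠ 0 := by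
  intro h
  have h1 : ‖exp (-(t : ℂ))‖ = 1 := by rw [← sub_eq_zero.1 h, norm_one]
  rw [Complex.norm_exp] at h1
  simp at h1
  exact ht.ne' h1

theorem locallyIntegrableOn_hurwitzKernel (c : ℕ → ℂ) (y : ℂ) (K : ℕ) :
    LocallyIntegrableOn (hurwitzKernel c y K) (Ioi 0) := by
  refine ContinuousOn.locallyIntegrableOn ?_ measurableSet_Ioi
  unfold hurwitzKernel
  refine ContinuousOn.mul (by fun_prop) (ContinuousOn.sub ?_ ?_)
  · exact ContinuousOn.inv₀ (by fun_prop) fun t ht => one_sub_exp_neg_ne_zero ht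
  · refine continuousOn_finsetSum _ fun j _ => ?_
    refine ContinuousOn.mul (by fun_prop) (ContinuousOn.div (by fun_prop) (by fun_prop) ?_)
    exact fun t ht => ofReal_ne_zero.2 (ne_of_gt ht)

/-- The bracket in the kernel grows at most polynomially, which costs only half of the decay rate
`y.re`. -/
theorem hurwitzKernel_isBigO_atTop (c : ℕ → ℂ) {y : ℂ} (hy : 0 < y.re) (K : ℕ) :
    hurwitzKernel c y K =O[atTop] fun t => Real.exp (-(y.re / 2) * t) := by
  have hb : 0 < y.re / 2 := by linarith
  have h1 : (fun t : ℝ => exp (-(y * t))) =O[atTop] fun t => Real.exp (-y.re * t) := by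
    refine IsBigO.of_bound 1 (Eventually.of_forall fun t => ?_)
    rw [Complex.norm_exp, one_mul, Real.norm_of_nonneg (Real.exp_pos _).le]
    simp
  have hone : (fun _ : ℝ => (1 : ℝ)) =O[atTop] fun t => Real.exp (y.re / 2 * t) := by
    simpa using (isLittleO_pow_exp_pos_mul_atTop 0 hb).isBigO
  have h2 : (fun t : ℝ => (1 - exp (-(t : ℂ)))⁻¹) =O[atTop] fun t => Real.exp (y.re / 2 * t) := by
    refine IsBigO.trans ?_ hone
    have hlim : Tendsto (fun t : ℝ => (1 - exp (-(t : ℂ)))⁻¹) atTop (𝓝 ((1 - 0)⁻¹)) := by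
      refine Tendsto.inv₀ (tendsto_const_nhds.sub ?_) (by simp)
      have : Tendsto (fun t : ℝ => ((Real.exp (-t) : ℝ) : ℂ)) atTop (𝓝 ((0 : ℝ) : ℂ)) :=
        (continuous_ofReal.tendsto _).comp (Real.tendsto_exp_neg_atTop_nhds_zero)
      simpa using this
    exact hlim.isBigO_one ℝ
  have h3 : ∀ j : ℕ, (fun t : ℝ => c j * ((t : ℂ) ^ j / t)) =O[atTop]
      fun t => Real.exp (y.re / 2 * t) := by
    intro j
    refine IsBigO.const_mul_left (IsBigO.trans ?_
      (isLittleO_zpow_exp_pos_mul_atTop ((j : ℤ) - 1) hb).isBigO) _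
    refine IsBigO.of_bound 1 ?_
    filter_upwards [eventually_gt_atTop 0] with t ht
    rw [one_mul, zpow_sub₀ ht.ne', zpow_natCast, zpow_one]
    simp
  have h4 := h1.mul (h2.sub (IsBigO.fun_sum (s := Finset.range K) fun j _ => h3 j))
  refine h4.congr_right fun t => ?_
  rw [← Real.exp_add]
  congr 1
  ring

/-- The bracket is `t⁻¹` times a Taylor remainder of order `t ^ K`. The exponent `K - 1` makes the
Mellin transform converge for `Re s > 1 - K`. -/
theorem hurwitzKernel_isBigO_zero {c : ℕ → ℂ} (hc : ∀ K : ℕ,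
    (fun t : ℝ => (t : ℂ) / (1 - exp (-t)) - ∑ j ∈ Finset.range K, c j * (t : ℂ) ^ j)
      =O[𝓝[>] 0] fun t : ℝ => t ^ K) (y : ℂ) (K : ℕ) :
    hurwitzKernel c y K =O[𝓝[>] 0] fun t : ℝ => t ^ (-(1 - K : ℝ)) := by
  have h1 : (fun t : ℝ => exp (-(y * t))) =O[𝓝[>] 0] fun _ => (1 : ℝ) := by
    have : Continuous fun t : ℝ => exp (-(y * t)) := by fun_prop
    exact ((this.tendsto 0).mono_left nhdsWithin_le_nhds).isBigO_one ℝ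
  have h2 : (fun t : ℝ => (t : ℂ)⁻¹) =O[𝓝[>] 0] fun t : ℝ => t⁻¹ := by
    refine IsBigO.of_bound 1 (Eventually.of_forall fun t => ?_)
    simp
  refine (h1.mul (h2.mul (hc K))).congr' ?_ ?_
  · filter_upwards [self_mem_nhdsWithin] with t ht
    have ht' : (t : ℂ) ≠ 0 := ofReal_ne_zero.2 (ne_of_gt ht)
    rw [hurwitzKernel, mul_sub, Finset.mul_sum, ← mul_div_assoc, inv_mul_cancel₀ ht', one_div]
    congr 2
    exact Finset.sum_congr rfl fun j _ => by ring
  · filter_upwards [self_mem_nhdsWithin] with t ht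
    have ht' : (0 : ℝ) < t := ht
    rw [neg_sub, Real.rpow_sub_one ht'.ne', Real.rpow_natCast]
    ring

/-- Shows that `(s - 1) Γ(s + j - 1) / Γ(s)` is a polynomial in `s`, so the removed Taylor terms
contribute entire functions. -/
theorem mul_Gamma_add_nat_sub_one {s : ℂ} (hs : 1 < s.re) (j : ℕ) :
    (s - 1) * Gamma (s + j - 1) = Gamma s * ∏ i ∈ Finset.range j, (s - 1 + i) := by
  have hre : ∀ j : ℕ, s + j - 1 ≠ 0 := fun j h => by
    have := congrArg re h
    simp at this
    linarith [(Nat.cast_nonneg j : (0 : ℝ) ≤ j)]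
  induction j with
  | zero =>
    have h := Gamma_add_one (s - 1) (by simpa using hre 0)
    simp only [sub_add_cancel] at h
    simp [h]
  | succ j ih =>
    have h := Gamma_add_one (s + j - 1) (hre j)
    rw [show s + ((j + 1 : ℕ) : ℂ) - 1 = s + j - 1 + 1 by push_cast; ring, h,
      Finset.prod_range_succ, ← mul_assoc (Gamma s), ← ih]
    ring

theorem mellin_hurwitzKernel {c : ℕ → ℂ} (hc : ∀ K : ℕ,
    (fun t : ℝ => (t : ℂ) / (1 - exp (-t)) - ∑ j ∈ Finset.range K, c j * (t : ℂ) ^ j)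
      =O[𝓝[>] 0] fun t : ℝ => t ^ K) {y s : ℂ} (hy : 0 < y.re) (hs : 1 < s.re) (K : ℕ) :
    mellin (hurwitzKernel c y K) s = mellin (hurwitzKernel c y 0) s
      - ∑ j ∈ Finset.range K, c j * (y ^ (-(s + j - 1)) * Gamma (s + j - 1)) := by
  have hre : ∀ j : ℕ, 0 < (s + j - 1).re := fun j => by
    simp only [sub_re, add_re, natCast_re, one_re]
    linarith [(Nat.cast_nonneg j : (0 : ℝ) ≤ j)]
  have h0 : MellinConvergent (hurwitzKernel c y 0) s :=
    mellinConvergent_of_isBigO_rpow_exp (by linarith : 0 < y.re / 2)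
      (locallyIntegrableOn_hurwitzKernel c y 0)
      (hurwitzKernel_isBigO_atTop c hy 0) (hurwitzKernel_isBigO_zero hc y 0) (by simpa using hs)
  have hI : ∀ j ∈ Finset.range K, IntegrableOn
      (fun t : ℝ => c j * ((t : ℂ) ^ (s + j - 1 - 1) * exp (-(y * t)))) (Ioi 0) := fun j _ =>
    (integrableOn_cpow_mul_exp_neg_mul (hre j) hy).const_mul (c j)
  simp_rw [← integral_cpow_mul_exp_neg_mul_Ioi_complex (hre _) hy, ← integral_const_mul]
  rw [← integral_finsetSum _ hI, mellin, mellin, ← integral_sub h0 (integrable_finsetSum _ hI)]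
  refine setIntegral_congr_fun measurableSet_Ioi fun t ht => ?_
  have ht' : (t : ℂ) ≠ 0 := ofReal_ne_zero.2 (ne_of_gt ht)
  simp only [hurwitzKernel, smul_eq_mul, Finset.range_zero, Finset.sum_empty, sub_zero]
  rw [mul_sub, mul_sub, Finset.mul_sum, Finset.mul_sum]
  congr 1
  refine Finset.sum_congr rfl fun j _ => ?_
  have h1 : (t : ℂ) ^ (s + j - 1 - 1) = (t : ℂ) ^ (s - 1) * ((t : ℂ) ^ j / t) := by
    rw [show s + j - 1 - 1 = s - 1 + j - 1 by ring, cpow_sub _ _ ht', cpow_add _ _ ht',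
      cpow_natCast, cpow_one, mul_div_assoc]
  rw [h1]
  ring

/-- Continuation of `(s - 1) ζ(s; y)` to the half-plane `Re s > 1 - K`. -/
theorem exists_differentiableOn_eq_hurwitz {y : ℂ} (hy : 0 < y.re) (K : ℕ) :
    ∃ G : ℂ → ℂ, DifferentiableOn ℂ G {s : ℂ | 1 - (K : ℝ) < s.re} ∧
      ∀ s : ℂ, 1 < s.re → G s = (s - 1) * ∑' m : ℕ, hurwitzTerm y s m := by
  obtain ⟨c, hc⟩ := exists_isBigO_div_one_sub_exp_sub
  -- The removed terms are added back with the Gamma quotient already written as a product, so the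
  -- formula has no poles in the larger half-plane.
  refine ⟨fun s => (s - 1) * (Gamma s)⁻¹ * mellin (hurwitzKernel c y K) s
    + ∑ j ∈ Finset.range K, c j * (y ^ (-(s + j - 1)) * ∏ i ∈ Finset.range j, (s - 1 + i)),
    fun s hs => ?_, fun s hs => ?_⟩
  · have h1 : DifferentiableAt ℂ (mellin (hurwitzKernel c y K)) s :=
      mellin_differentiableAt_of_isBigO_rpow_exp (by linarith : 0 < y.re / 2)
        (locallyIntegrableOn_hurwitzKernel c y K)
        (hurwitzKernel_isBigO_atTop c hy K) (hurwitzKernel_isBigO_zero hc y K) hs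
    have h2 := differentiable_one_div_Gamma s
    have hy0 := ne_zero_of_zero_lt_re hy
    refine DifferentiableAt.differentiableWithinAt ?_
    refine (((differentiableAt_id.sub_const 1).mul h2).mul h1).add ?_
    refine DifferentiableAt.fun_sum fun j _ => ?_
    refine ((DifferentiableAt.const_cpow (by fun_prop) (Or.inl hy0)).mul ?_).const_mul _
    fun_prop
  · have hG : Gamma s ≠ 0 := Gamma_ne_zero_of_re_pos (by linarith)
    have h0 : mellin (hurwitzKernel c y 0) s = Gamma s * ∑' m : ℕ, hurwitzTerm y s m := by
      rw [← tsum_mul_left, (hasSum_Gamma_mul_hurwitzTerm hy hs).tsum_eq]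
      congr 1 with t
      simp [hurwitzKernel, div_eq_mul_inv]
    have hj : ∀ j : ℕ, ∏ i ∈ Finset.range j, (s - 1 + (i : ℂ))
        = (s - 1) * (Gamma s)⁻¹ * Gamma (s + j - 1) := fun j => by
      rw [mul_right_comm, mul_Gamma_add_nat_sub_one hs j]
      field_simp
    simp only [hj]
    rw [mellin_hurwitzKernel hc hy hs K, h0, mul_sub, Finset.mul_sum, ← mul_assoc,
      mul_assoc (s - 1), inv_mul_cancel₀ hG, mul_one, sub_add, sub_eq_self, sub_eq_zero]
    exact Finset.sum_congr rfl fun j _ => by ring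

/-- Functions on the half-planes `Re s > 1 - K` that continue the same function glue to an entire
one. -/
theorem exists_differentiable_of_halfPlanes {f : ℂ → ℂ}
    (h : ∀ K : ℕ, ∃ G : ℂ → ℂ, DifferentiableOn ℂ G {s : ℂ | 1 - (K : ℝ) < s.re} ∧
      ∀ s : ℂ, 1 < s.re → G s = f s) :
    ∃ H : ℂ → ℂ, Differentiable ℂ H ∧ ∀ s : ℂ, 1 < s.re → H s = f s := by
  choose G hG hGf using h
  have hopen : ∀ b : ℝ, IsOpen {s : ℂ | b < s.re} := fun b =>
    isOpen_lt continuous_const continuous_re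
  have hle : ∀ K L : ℕ, K ≤ L → ∀ s : ℂ, 1 - (K : ℝ) < s.re → G K s = G L s := by
    intro K L hKL s hs
    have hKL' : (K : ℝ) ≤ L := by exact_mod_cast hKL
    have hsub : {s : ℂ | 1 - (K : ℝ) < s.re} ⊆ {s : ℂ | 1 - (L : ℝ) < s.re} := fun w hw => by
      simp only [mem_ofPred_eq] at hw ⊢
      linarith
    refine ((hG K).analyticOnNhd (hopen _)).eqOn_of_preconnected_of_eventuallyEq
      (((hG L).mono hsub).analyticOnNhd (hopen _))
      (convex_halfSpace_re_gt _).isPreconnected (z₀ := 2) ?_ ?_ hs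
    · simp only [mem_ofPred_eq, re_ofNat]
      linarith [(Nat.cast_nonneg K : (0 : ℝ) ≤ K)]
    · filter_upwards [(hopen 1).mem_nhds (by simp : (2 : ℂ) ∈ {s : ℂ | 1 < s.re})] with w hw
      rw [hGf K w hw, hGf L w hw]
  have heq : ∀ K L : ℕ, ∀ s : ℂ, 1 - (K : ℝ) < s.re → 1 - (L : ℝ) < s.re → G K s = G L s := by
    intro K L s hK hL
    rcases le_total K L with h | h
    · exact hle K L h s hK
    · exact (hle L K h s hL).symm
  -- With this index, `1 - K ≤ -1 - |s.re| < s.re`, so every `s` lies in the half-plane chosen for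
  -- it.
  have hceil : ∀ s : ℂ, 1 - ((⌈|s.re|⌉₊ + 2 : ℕ) : ℝ) < s.re := fun s => by
    push_cast
    linarith [Nat.le_ceil |s.re|, neg_abs_le s.re]
  refine ⟨fun s => G (⌈|s.re|⌉₊ + 2) s, fun s => ?_, fun s hs => hGf _ s hs⟩
  have hs := hceil s
  refine (((hG _).differentiableAt ((hopen _).mem_nhds hs))).congr_of_eventuallyEq ?_
  filter_upwards [(hopen _).mem_nhds hs] with w hw
  exact heq _ _ w (hceil w) hw

/-! ### Normal forms and the continued Hurwitz function -/

theorem toMeromorphicNFOn_univ_eq {f : ℂ → ℂ} (hf : MeromorphicOn f univ) {s : ℂ}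
    (hs : AnalyticAt ℂ f s) : toMeromorphicNFOn f univ s = f s := by
  rw [toMeromorphicNFOn_eq_toMeromorphicNFAt hf (mem_univ s),
    toMeromorphicNFAt_eq_self.2 hs.meromorphicNFAt]

/-- A meromorphic function that is analytic and agrees with `f` for `Re s > σ` has the continuation
of `f` as its normal form. -/
theorem isMeromorphicContinuation_toMeromorphicNFOn {σ : ℝ} {f F : ℂ → ℂ}
    (hF : MeromorphicOn F univ) (ha : ∀ s : ℂ, σ < s.re → AnalyticAt ℂ F s)
    (he : ∀ s : ℂ, σ < s.re → F s = f s) :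
    IsMeromorphicContinuation σ f (toMeromorphicNFOn F univ) :=
  ⟨meromorphicNFOn_toMeromorphicNFOn F univ, fun s hs => by
    rw [toMeromorphicNFOn_univ_eq hF (ha s hs), he s hs]⟩

theorem isMeromorphicContinuation_meromorphicContinuation {σ : ℝ} {f F : ℂ → ℂ}
    (h : IsMeromorphicContinuation σ f F) :
    IsMeromorphicContinuation σ f (meromorphicContinuation σ f) := by
  have hex : ∃ F, IsMeromorphicContinuation σ f F := ⟨F, h⟩
  rw [meromorphicContinuation, dif_pos hex]
  exact hex.choose_spec

theorem meromorphicContinuation_eq {σ : ℝ} {f F : ℂ → ℂ}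
    (h : IsMeromorphicContinuation σ f F) : meromorphicContinuation σ f = F :=
  (isMeromorphicContinuation_meromorphicContinuation h).unique h

/-- The Hurwitz zeta function with parameter `Re y > 0` is the continuation of its series, and it is
analytic except at `1`. -/
theorem hurwitzZeta_spec {y : ℂ} (hy : 0 < y.re) :
    IsMeromorphicContinuation 1 (fun s => ∑' m : ℕ, hurwitzTerm y s m) (hurwitzZeta y) ∧
      ∀ s : ℂ, s ≠ 1 → AnalyticAt ℂ (hurwitzZeta y) s := by
  obtain ⟨H, hH, hHf⟩ :=
    exists_differentiable_of_halfPlanes fun K => exists_differentiableOn_eq_hurwitz hy K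
  have hHa : ∀ s, AnalyticAt ℂ H s := fun s =>
    (hH.differentiableOn (s := univ)).analyticAt univ_mem
  have hmer : MeromorphicOn (fun s => H s / (s - 1)) univ := fun s _ =>
    (hHa s).meromorphicAt.fun_div (by fun_prop : AnalyticAt ℂ (fun s : ℂ => s - 1) s).meromorphicAt
  have hana : ∀ s : ℂ, s ≠ 1 → AnalyticAt ℂ (fun s => H s / (s - 1)) s := fun s hs =>
    (hHa s).fun_div (by fun_prop) (sub_ne_zero.2 hs)
  have hne : ∀ s : ℂ, 1 < s.re → s ≠ 1 := by
    rintro s hs rfl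
    simp at hs
  have hcont : IsMeromorphicContinuation 1 (fun s => ∑' m : ℕ, hurwitzTerm y s m)
      (toMeromorphicNFOn (fun s => H s / (s - 1)) univ) := by
    refine isMeromorphicContinuation_toMeromorphicNFOn hmer (fun s hs => hana s (hne s hs))
      fun s hs => ?_
    rw [hHf s hs, mul_div_cancel_left₀ _ (sub_ne_zero.2 (hne s hs))]
  refine ⟨isMeromorphicContinuation_meromorphicContinuation hcont, fun s hs => ?_⟩
  rw [hurwitzZeta, meromorphicContinuation_eq hcont]
  refine (hana s hs).congr ?_
  filter_upwards [isOpen_ne.mem_nhds hs] with w hw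
  exact (toMeromorphicNFOn_univ_eq hmer (hana w hw)).symm

end BarnesZeta

end

namespace BarnesZeta

/-! ### Difference equations for Nörlund and Bernoulli–Barnes coefficients -/

open PowerSeries in
theorem constantCoeff_expSubOneDivX (c : ℂ) : constantCoeff (expSubOneDivX c) = c := by
  rw [← coeff_zero_eq_constantCoeff_apply, expSubOneDivX, coeff_mk]
  simp [coeff_rescale, coeff_exp, coeff_one]

open PowerSeries in
/-- The coefficient of `z ^ k` in `e ^ (y z) (z / (e ^ z - 1)) ^ (k + 1)`. -/
noncomputable def norlundCoeff (k : ℕ) (y : ℂ) : ℂ :=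
  coeff k (rescale y (exp ℂ) * (expSubOneDivX 1)⁻¹ ^ (k + 1))

open PowerSeries in
theorem norlundCoeff_zero (y : ℂ) : norlundCoeff 0 y = 1 := by
  have h : constantCoeff (rescale y (exp ℂ)) = 1 := by
    rw [← coeff_zero_eq_constantCoeff_apply, coeff_rescale, coeff_zero_eq_constantCoeff_apply]
    simp
  rw [norlundCoeff, coeff_zero_eq_constantCoeff_apply, map_mul, h, map_pow, constantCoeff_inv,
    constantCoeff_expSubOneDivX]
  simp

open PowerSeries in
theorem expSubOneDivX_mul_inv {c : ℂ} (hc : c ≠ 0) :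
    expSubOneDivX c * (expSubOneDivX c)⁻¹ = 1 :=
  PowerSeries.mul_inv_cancel _ (by rwa [constantCoeff_expSubOneDivX])

open PowerSeries in
theorem rescale_add_exp_sub (y c : ℂ) :
    rescale (y + c) (exp ℂ) - rescale y (exp ℂ) = X * (rescale y (exp ℂ) * expSubOneDivX c) := by
  rw [← exp_mul_exp_eq_exp_add, mul_left_comm, X_mul_expSubOneDivX]
  ring

open PowerSeries in
-- The factor `e ^ z - 1` from the difference cancels one factor `z / (e ^ z - 1)` and leaves one
-- `z`, which lowers the index.
theorem norlundCoeff_add_one_sub (k : ℕ) (y : ℂ) :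
    norlundCoeff (k + 1) (y + 1) - norlundCoeff (k + 1) y = norlundCoeff k y := by
  rw [norlundCoeff, norlundCoeff, ← map_sub, ← sub_mul, rescale_add_exp_sub, mul_assoc,
    coeff_succ_X_mul, norlundCoeff, pow_succ' _ (k + 1), mul_assoc,
    ← mul_assoc (expSubOneDivX 1), expSubOneDivX_mul_inv one_ne_zero, one_mul]

open PowerSeries in
-- The coefficient is the residue at `0` of `e ^ z / (e ^ z - 1) ^ (k + 2)`, a multiple of the
-- derivative of `(e ^ z - 1) ^ (-(k + 1))`; a derivative has no residue. The proof phrases this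
-- with `E = (e ^ z - 1) / z`, where `e ^ z = E + z E'`.
theorem norlundCoeff_succ_one (k : ℕ) : norlundCoeff (k + 1) 1 = 0 := by
  have hE := expSubOneDivX_mul_inv (one_ne_zero (α := ℂ))
  set E := expSubOneDivX 1 with hEdef
  have h1 : rescale (1 : ℂ) (exp ℂ) = E + X * derivative ℂ E := by
    have h := congrArg (derivative ℂ) (X_mul_expSubOneDivX 1)
    rw [Derivation.leibniz, map_sub, Derivation.map_one_eq_zero, sub_zero, rescale_one,
      RingHom.id_apply, derivative_exp, derivative_X] at h
    rw [rescale_one, RingHom.id_apply, ← h, smul_eq_mul, smul_eq_mul, mul_one, add_comm]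
  have h2 : derivative ℂ (E⁻¹ ^ (k + 1))
      = -((k + 1 : ℕ) : ℂ⟦X⟧) * (derivative ℂ E * E⁻¹ ^ (k + 2)) := by
    rw [derivative_pow, derivative_inv', Nat.add_sub_cancel]
    ring
  have h3 := congrArg (coeff k) h2
  rw [coeff_derivative, ← map_natCast (C (R := ℂ)), ← map_neg, coeff_C_mul] at h3
  have h4 : rescale (1 : ℂ) (exp ℂ) * E⁻¹ ^ (k + 2)
      = E⁻¹ ^ (k + 1) + X * (derivative ℂ E * E⁻¹ ^ (k + 2)) := by
    rw [h1, add_mul, pow_succ' _ (k + 1), ← mul_assoc, hE, one_mul, mul_assoc]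
  rw [norlundCoeff, ← hEdef, h4, map_add, coeff_succ_X_mul]
  have hk : ((k : ℂ) + 1) ≠ 0 := Nat.cast_add_one_ne_zero k
  refine mul_left_cancel₀ hk ?_
  push_cast at h3
  linear_combination h3

/-- The difference equation matches Pascal's rule; the vanishing at `1` supplies the start `N = 0`.
-/
theorem norlundCoeff_neg_natCast (k N : ℕ) :
    norlundCoeff k (-(N : ℂ)) = (-1) ^ k * ((N + k).choose k : ℂ) := by
  induction k generalizing N with
  | zero => simp [norlundCoeff_zero]
  | succ k ih =>
    induction N with
    | zero =>
      have h := norlundCoeff_add_one_sub k 0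
      have h0 := ih 0
      rw [zero_add, norlundCoeff_succ_one] at h
      simp only [Nat.cast_zero, neg_zero, zero_add, Nat.choose_self] at h0 ⊢
      rw [h0] at h
      linear_combination -h
    | succ N ihN =>
      have h := norlundCoeff_add_one_sub k (-((N + 1 : ℕ) : ℂ))
      rw [ih, show -((N + 1 : ℕ) : ℂ) + 1 = -(N : ℂ) by push_cast; ring, ihN] at h
      have hc : (N + 1 + (k + 1)).choose (k + 1)
          = (N + 1 + k).choose k + (N + (k + 1)).choose (k + 1) := by
        rw [show N + 1 + (k + 1) = (N + 1 + k) + 1 by ring, Nat.choose_succ_succ,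
          show N + 1 + k = N + (k + 1) by ring]
      rw [hc]
      generalize norlundCoeff (k + 1) (-((N + 1 : ℕ) : ℂ)) = u at h ⊢
      push_cast
      linear_combination -h

open PowerSeries in
theorem bernoulliBarnesSeries_consOnes (a n : ℕ) (x : ℂ) :
    bernoulliBarnesSeries (consOnes a n) x
      = rescale x (exp ℂ) * ((expSubOneDivX (a : ℂ))⁻¹ * (expSubOneDivX 1)⁻¹ ^ n) := by
  simp [bernoulliBarnesSeries, consOnes, Fin.prod_univ_succ]

open PowerSeries in
-- A step of length `a` cancels the factor belonging to the entry `a`, so only the `k + 1` unit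
-- entries remain.
theorem bernoulliBarnes_consOnes_add_sub {a : ℕ} (ha : a ≠ 0) (k : ℕ) (y : ℂ) :
    bernoulliBarnes (k + 1) (y + a) (consOnes a (k + 1)) -
      bernoulliBarnes (k + 1) y (consOnes a (k + 1))
        = ((k + 1).factorial : ℂ) * norlundCoeff k y := by
  rw [bernoulliBarnes, bernoulliBarnes, ← mul_sub, ← map_sub, bernoulliBarnesSeries_consOnes,
    bernoulliBarnesSeries_consOnes, ← sub_mul, rescale_add_exp_sub, mul_assoc, coeff_succ_X_mul,
    norlundCoeff, mul_assoc, ← mul_assoc (expSubOneDivX (a : ℂ)),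
    expSubOneDivX_mul_inv (Nat.cast_ne_zero.2 ha), one_mul]

open PowerSeries in
/-- The addition theorem for Bernoulli–Barnes polynomials. -/
theorem bernoulliBarnes_add {d : ℕ} (v : Fin d → ℝ) (n : ℕ) (x y : ℂ) :
    bernoulliBarnes n (x + y) v
      = ∑ k ∈ Finset.range (n + 1), (n.choose k : ℂ) * bernoulliBarnes (n - k) x v * y ^ k := by
  have h : bernoulliBarnesSeries v (x + y)
      = rescale y (exp ℂ) * bernoulliBarnesSeries v x := by
    rw [bernoulliBarnesSeries, bernoulliBarnesSeries, ← exp_mul_exp_eq_exp_add]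
    ring
  rw [bernoulliBarnes, h, coeff_mul, Finset.Nat.sum_antidiagonal_eq_sum_range_succ_mk,
    Finset.mul_sum]
  refine Finset.sum_congr rfl fun k hk => ?_
  have hkn : k ≤ n := Nat.lt_succ_iff.1 (Finset.mem_range.1 hk)
  have hf : (n.factorial : ℂ) = n.choose k * k.factorial * (n - k).factorial := by
    exact_mod_cast (Nat.choose_mul_factorial_mul_factorial hkn).symm
  have hk0 : (k.factorial : ℂ) ≠ 0 := Nat.cast_ne_zero.2 k.factorial_ne_zero
  rw [bernoulliBarnes, hf, coeff_rescale, coeff_exp]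
  simp only [map_div₀, map_one, map_natCast]
  field_simp

/-! ### Counting the lattice points with a given sum -/

/-- The number of solutions of `a m₀ + m₁ + ⋯ + mₙ = N`. -/
theorem card_fiber_consOnes {a : ℕ} (ha : a ≠ 0) (k N : ℕ) :
    Nat.card {m : Fin (k + 2) → ℕ // a * m 0 + ∑ i : Fin (k + 1), m i.succ = N}
      = ∑ j ∈ Finset.range (N / a + 1), (N - a * j + k).choose k := by
  let e : (Σ j : Fin (N / a + 1), {t : Fin (k + 1) → ℕ // ∑ i, t i = N - a * j}) →
      {m : Fin (k + 2) → ℕ // a * m 0 + ∑ i : Fin (k + 1), m i.succ = N} :=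
    fun p => ⟨Fin.cons p.1.1 p.2.1, by
      have h1 := p.2.2
      have h2 : a * p.1.1 ≤ N := (Nat.mul_le_mul_left a (Nat.lt_succ_iff.1 p.1.2)).trans
        (Nat.mul_div_le N a)
      simp only [Fin.cons_zero, Fin.cons_succ]
      omega⟩
  have he : Function.Bijective e := by
    constructor
    · rintro ⟨⟨j, hj⟩, ⟨t, ht⟩⟩ ⟨⟨j', hj'⟩, ⟨t', ht'⟩⟩ h
      have h' : (Fin.cons j t : Fin (k + 2) → ℕ) = Fin.cons j' t' := congrArg Subtype.val h
      obtain ⟨rfl, rfl⟩ := Fin.cons_inj.1 h'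
      rfl
    · rintro ⟨m, hm⟩
      have hj : m 0 < N / a + 1 := Nat.lt_succ_iff.2
        ((Nat.le_div_iff_mul_le (Nat.pos_of_ne_zero ha)).2 (by rw [mul_comm]; omega))
      refine ⟨⟨⟨m 0, hj⟩, ⟨Fin.tail m, ?_⟩⟩, Subtype.ext (Fin.cons_self_tail m)⟩
      simp only [Fin.tail]
      omega
  -- Stars and bars: the tuples with sum `M` are multisets of size `M` on `k + 1` letters.
  have hsym : ∀ M : ℕ, Nat.card {t : Fin (k + 1) → ℕ // ∑ i, t i = M} = (M + k).choose k := by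
    intro M
    rw [← Nat.card_congr (Sym.equivNatSumOfFintype (Fin (k + 1)) M), Nat.card_eq_fintype_card,
      Sym.card_sym_eq_choose, Fintype.card_fin, show k + 1 + M - 1 = M + k by omega,
      Nat.choose_symm_add]
  have hfin : ∀ M : ℕ, Finite {t : Fin (k + 1) → ℕ // ∑ i, t i = M} := fun M =>
    Finite.of_equiv _ (Sym.equivNatSumOfFintype (Fin (k + 1)) M)
  rw [← Nat.card_congr (Equiv.ofBijective e he), Nat.card_sigma, ← Fin.sum_univ_eq_sum_range
    fun j => (N - a * j + k).choose k]
  exact Finset.sum_congr rfl fun j _ => hsym _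

/-- The number of solutions of `a m₀ + m₁ + ⋯ + mₙ = N` through Bernoulli–Barnes polynomials. -/
theorem card_fiber_consOnes_eq {a : ℕ} (ha : a ≠ 0) (k N : ℕ) :
    (Nat.card {m : Fin (k + 2) → ℕ // a * m 0 + ∑ i : Fin (k + 1), m i.succ = N} : ℂ)
      = (-1) ^ (k + 1) / ((k + 1).factorial : ℂ) *
          (bernoulliBarnes (k + 1) (-(N : ℂ)) (consOnes a (k + 1)) -
            bernoulliBarnes (k + 1) ((a - N % a : ℕ) : ℂ) (consOnes a (k + 1))) := by
  have hf : ((k + 1).factorial : ℂ) ≠ 0 := Nat.cast_ne_zero.2 (Nat.factorial_ne_zero _)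
  set B : ℂ → ℂ := fun y => bernoulliBarnes (k + 1) y (consOnes a (k + 1)) with hB
  have hstep : ∀ j ∈ Finset.range (N / a + 1), (((N - a * j + k).choose k : ℕ) : ℂ)
      = (-1) ^ k / ((k + 1).factorial : ℂ) *
        (B (-(N : ℂ) + a * ((j + 1 : ℕ) : ℂ)) - B (-(N : ℂ) + a * (j : ℂ))) := by
    intro j hj
    have h2 : a * j ≤ N := (Nat.mul_le_mul_left a (Nat.lt_succ_iff.1 (Finset.mem_range.1 hj))).trans
      (Nat.mul_div_le N a)
    have h3 : -(N : ℂ) + a * (j : ℂ) = -((N - a * j : ℕ) : ℂ) := by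
      push_cast [Nat.cast_sub h2]
      ring
    have h4 : -(N : ℂ) + a * ((j + 1 : ℕ) : ℂ) = -((N - a * j : ℕ) : ℂ) + a := by
      rw [← h3]
      push_cast
      ring
    rw [h3, h4, hB]
    simp only
    rw [bernoulliBarnes_consOnes_add_sub ha, norlundCoeff_neg_natCast]
    have hs : ((-1 : ℂ) ^ k) * (-1) ^ k = 1 := by rw [← mul_pow]; simp
    field_simp
    linear_combination -((N - a * j + k).choose k : ℂ) * hs
  -- The upper end of the telescoping sum depends only on `N` modulo `a` and lies in `{1, …, a}`.
  have hr : -(N : ℂ) + a * ((N / a + 1 : ℕ) : ℂ) = ((a - N % a : ℕ) : ℂ) := by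
    have h5 : (N : ℂ) = a * ((N / a : ℕ) : ℂ) + ((N % a : ℕ) : ℂ) := by
      exact_mod_cast (Nat.div_add_mod N a).symm
    rw [Nat.cast_sub (Nat.mod_lt N (Nat.pos_of_ne_zero ha)).le]
    push_cast
    linear_combination -h5
  rw [card_fiber_consOnes ha, Nat.cast_sum, Finset.sum_congr rfl hstep, ← Finset.mul_sum,
    Finset.sum_range_sub (fun j : ℕ => B (-(N : ℂ) + a * (j : ℂ))), hr]
  simp only [Nat.cast_zero, mul_zero, add_zero, pow_succ]
  ring

end BarnesZeta

section

open Complex Set Filter Topology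

namespace BarnesZeta

/-! ### Rearranging the Barnes series into Hurwitz series -/

/-- Summation over finite fibers. -/
theorem summable_and_tsum_comp_of_card_fiber {ι : Type*} (φ : ι → ℕ)
    (hφ : ∀ N, Finite {m // φ m = N}) (f : ℕ → ℂ)
    (h : Summable fun N => (Nat.card {m // φ m = N} : ℂ) * f N) :
    Summable (fun m => f (φ m)) ∧
      ∑' m, f (φ m) = ∑' N, (Nat.card {m // φ m = N} : ℂ) * f N := by
  have hfib : ∀ (N : ℕ) (p : {m // φ m = N}), f (φ (Equiv.sigmaFiberEquiv φ ⟨N, p⟩)) = f N :=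
    fun N p => congrArg f p.2
  have hsum : Summable fun p : Σ N, {m // φ m = N} => f (φ (Equiv.sigmaFiberEquiv φ p)) := by
    -- Terms are constant on a fiber, so the norms over it add up to the norm of the weighted term.
    refine Summable.of_norm ((summable_sigma_of_nonneg fun p => norm_nonneg _).2
      ⟨fun N => Summable.of_finite, h.norm.congr fun N => ?_⟩)
    simp_rw [hfib]
    rw [tsum_const, nsmul_eq_mul, norm_mul, norm_natCast]
  refine ⟨(Equiv.summable_iff (Equiv.sigmaFiberEquiv φ)).1 hsum, ?_⟩
  rw [← (Equiv.sigmaFiberEquiv φ).tsum_eq, hsum.tsum_sigma]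
  congr 1 with N
  simp_rw [hfib]
  rw [tsum_const, nsmul_eq_mul]

/-- Multiplying by a positive real leaves the argument unchanged, so the principal logarithm is
additive here. -/
theorem natCast_cpow_neg_mul_one_div_cpow {a : ℕ} (ha : a ≠ 0) {z : ℂ} (hz : z ≠ 0) (s : ℂ) :
    (a : ℂ) ^ (-s) * (1 / z ^ s) = 1 / (a * z) ^ s := by
  have ha' : (a : ℂ) ≠ 0 := Nat.cast_ne_zero.2 ha
  have hpos : (0 : ℝ) < a := Nat.cast_pos.2 (Nat.pos_of_ne_zero ha)
  have hlog : log (a * z) = log a + log z := by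
    have h := log_ofReal_mul hpos hz
    rwa [ofReal_log hpos.le, ofReal_natCast] at h
  have hmul : ((a : ℂ) * z) ^ s = (a : ℂ) ^ s * z ^ s := by
    rw [cpow_def_of_ne_zero (mul_ne_zero ha' hz), cpow_def_of_ne_zero ha',
      cpow_def_of_ne_zero hz, hlog, add_mul, exp_add]
  rw [hmul, cpow_neg, one_div, one_div, mul_inv]

theorem re_one_add_sub_div_pos {a r : ℕ} (ha : a ≠ 0) (hr : r ≤ a) {x : ℂ} (hx : 0 < x.re) :
    0 < (1 + (x - r) / a : ℂ).re := by
  have hpos : (0 : ℝ) < a := Nat.cast_pos.2 (Nat.pos_of_ne_zero ha)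
  have hr' : (r : ℝ) ≤ a := by exact_mod_cast hr
  have h : (1 + (x - r) / a : ℂ).re = (a + x.re - r) / a := by
    rw [add_re, div_natCast_re, sub_re, natCast_re, one_re]
    field_simp
    ring
  rw [h]
  exact div_pos (by linarith) hpos

/-- The Hurwitz series weighted by a function of the residue modulo `a`. -/
theorem hasSum_mod_mul_hurwitzTerm {a : ℕ} (ha : a ≠ 0) (b : ℕ → ℂ) {x s : ℂ} (hx : 0 < x.re)
    (hs : 1 < s.re) :
    HasSum (fun N : ℕ => b (a - N % a) * hurwitzTerm x s N)
      ((a : ℂ) ^ (-s) * ∑ r ∈ Finset.Icc 1 a, b r * ∑' m, hurwitzTerm (1 + (x - r) / a) s m) := by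
  have : NeZero a := ⟨ha⟩
  have ha' : (a : ℂ) ≠ 0 := Nat.cast_ne_zero.2 ha
  have hsum : Summable fun N : ℕ => b (a - N % a) * hurwitzTerm x s N := by
    refine Summable.of_norm_bounded
      ((summable_norm_hurwitzTerm hx hs).mul_left (∑ r ∈ Finset.Icc 1 a, ‖b r‖)) fun N => ?_
    rw [norm_mul]
    gcongr
    have hN := Nat.mod_lt N (Nat.pos_of_ne_zero ha)
    exact Finset.single_le_sum (f := fun r => ‖b r‖) (fun r _ => norm_nonneg _)
      (Finset.mem_Icc.2 ⟨by omega, Nat.sub_le _ _⟩)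
  -- For `N = q a + (a - r)` one has `x + N = a (1 + (x - r) / a + q)`.
  have hterm : ∀ r ∈ Finset.Icc 1 a, ∀ q : ℕ, hurwitzTerm x s (q * a + (a - r))
      = (a : ℂ) ^ (-s) * hurwitzTerm (1 + (x - r) / a) s q := by
    intro r hr q
    have hra := (Finset.mem_Icc.1 hr).2
    rw [hurwitzTerm, hurwitzTerm, natCast_cpow_neg_mul_one_div_cpow ha
      (ne_zero_of_zero_lt_re (add_nat_re_pos (re_one_add_sub_div_pos ha hra hx) q))]
    congr 2
    push_cast [Nat.cast_sub hra]
    field_simp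
    ring
  convert hsum.hasSum using 1
  symm
  rw [← (Nat.divModEquiv a).symm.tsum_eq, ← (Equiv.prodComm (Fin a) ℕ).tsum_eq]
  refine (Summable.tsum_prod ((Equiv.prodComm (Fin a) ℕ).summable_iff.2
    ((Nat.divModEquiv a).symm.summable_iff.2 hsum))).trans ?_
  rw [tsum_fintype, Finset.mul_sum]
  have hinner : ∀ t : Fin a, ∑' q : ℕ, b (a - ((Nat.divModEquiv a).symm (q, t)) % a) *
        hurwitzTerm x s ((Nat.divModEquiv a).symm (q, t))
      = b (a - t) * ∑' q : ℕ, hurwitzTerm x s (q * a + t) := by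
    intro t
    rw [← tsum_mul_left]
    congr 1 with q
    have h1 : (Nat.divModEquiv a).symm (q, t) = q * a + t := rfl
    rw [h1, Nat.mul_add_mod_of_lt t.2]
  simp only [Equiv.prodComm_apply, Prod.swap_prod_mk, Function.comp_apply, hinner]
  rw [Fin.sum_univ_eq_sum_range fun t => b (a - t) * ∑' q : ℕ, hurwitzTerm x s (q * a + t)]
  refine Finset.sum_nbij' (fun t => a - t) (fun r => a - r) ?_ ?_ ?_ ?_ ?_
  · intro t ht
    simp only [Finset.mem_range, Finset.mem_Icc] at ht ⊢
    omega
  · intro r hr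
    simp only [Finset.mem_range, Finset.mem_Icc] at hr ⊢
    omega
  · intro t ht
    simp only [Finset.mem_range] at ht
    omega
  · intro r hr
    simp only [Finset.mem_Icc] at hr
    omega
  · intro t ht
    have ht' := Finset.mem_range.1 ht
    have hr : a - t ∈ Finset.Icc 1 a := Finset.mem_Icc.2 ⟨by omega, Nat.sub_le _ _⟩
    have h2 := hterm (a - t) hr
    rw [Nat.sub_sub_self ht'.le] at h2
    simp_rw [h2]
    rw [tsum_mul_left]
    ring

theorem pow_mul_hurwitzTerm {x : ℂ} (hx : 0 < x.re) (s : ℂ) (k N : ℕ) :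
    (x + N) ^ k * hurwitzTerm x s N = hurwitzTerm x (s - k) N := by
  have h := ne_zero_of_zero_lt_re (add_nat_re_pos hx N)
  rw [hurwitzTerm, hurwitzTerm, cpow_sub _ _ h, cpow_natCast]
  have h2 : (x + N : ℂ) ^ s ≠ 0 := by simp [cpow_eq_zero_iff, h]
  field_simp

theorem barnesTerm_consOnes (a k : ℕ) (x s : ℂ) (m : Fin (k + 2) → ℕ) :
    barnesTerm (consOnes a (k + 1)) x s m
      = hurwitzTerm x s (a * m 0 + ∑ i : Fin (k + 1), m i.succ) := by
  rw [barnesTerm, hurwitzTerm, Fin.sum_univ_succ]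
  simp [consOnes, mul_comm]

/-- The right-hand side of the evaluation, with a function `Z x s` for the Hurwitz zeta function. -/
noncomputable def barnesHurwitzSum (Z : ℂ → ℂ → ℂ) (n a : ℕ) (x s : ℂ) : ℂ :=
  (-1 : ℂ) ^ n / (n.factorial : ℂ) *
      ∑ k ∈ Finset.range (n + 1),
        (-1 : ℂ) ^ k * (n.choose k : ℂ) * bernoulliBarnes (n - k) x (consOnes a n) * Z x (s - k) +
    (-1 : ℂ) ^ (n - 1) / (n.factorial : ℂ) * (a : ℂ) ^ (-s) *
      ∑ r ∈ Finset.Icc 1 a,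
        bernoulliBarnes n (r : ℂ) (consOnes a n) * Z (1 + (x - r) / a) s

/-- Every shift satisfies `j ≤ k + 1`, so `Re (s - j) > 1` and all the Hurwitz series involved
converge. -/
theorem hasSum_card_fiber_mul_hurwitzTerm {a : ℕ} (ha : a ≠ 0) (k : ℕ) {x s : ℂ} (hx : 0 < x.re)
    (hs : ((k + 1 + 1 : ℕ) : ℝ) < s.re) :
    HasSum (fun N : ℕ =>
        (Nat.card {m : Fin (k + 2) → ℕ // a * m 0 + ∑ i : Fin (k + 1), m i.succ = N} : ℂ) *
          hurwitzTerm x s N)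
      (barnesHurwitzSum (fun y w => ∑' m : ℕ, hurwitzTerm y w m) (k + 1) a x s) := by
  push_cast at hs
  have hs1 : 1 < s.re := by linarith [(Nat.cast_nonneg k : (0 : ℝ) ≤ k)]
  have hA : ∀ j ∈ Finset.range (k + 2), HasSum
      (fun N : ℕ => (-1 : ℂ) ^ j * ((k + 1).choose j : ℂ) *
        bernoulliBarnes (k + 1 - j) x (consOnes a (k + 1)) * hurwitzTerm x (s - j) N)
      ((-1 : ℂ) ^ j * ((k + 1).choose j : ℂ) *
        bernoulliBarnes (k + 1 - j) x (consOnes a (k + 1)) *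
          ∑' m : ℕ, hurwitzTerm x (s - j) m) := by
    intro j hj
    have hj' : (j : ℝ) ≤ k + 1 := by
      exact_mod_cast Nat.lt_succ_iff.1 (Finset.mem_range.1 hj)
    have hre : 1 < (s - j).re := by
      rw [sub_re, natCast_re]
      linarith
    exact (summable_norm_hurwitzTerm hx hre).of_norm.hasSum.mul_left _
  have hB := hasSum_mod_mul_hurwitzTerm ha
    (fun r => bernoulliBarnes (k + 1) (r : ℂ) (consOnes a (k + 1))) hx hs1
  have h := ((hasSum_sum hA).mul_left ((-1 : ℂ) ^ (k + 1) / ((k + 1).factorial : ℂ))).add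
    (hB.mul_left ((-1 : ℂ) ^ k / ((k + 1).factorial : ℂ)))
  rw [barnesHurwitzSum, Nat.add_sub_cancel, mul_assoc ((-1 : ℂ) ^ k / ((k + 1).factorial : ℂ))]
  refine h.congr_fun ?_
  intro N
  -- Expanding around `x` produces powers of `x + N`, which `pow_mul_hurwitzTerm` absorbs into the
  -- exponent.
  rw [card_fiber_consOnes_eq ha, show -(N : ℂ) = x + -(x + N) by ring, bernoulliBarnes_add,
    mul_assoc, sub_mul, Finset.sum_mul]
  have h1 : ∀ j : ℕ, ((k + 1).choose j : ℂ) * bernoulliBarnes (k + 1 - j) x (consOnes a (k + 1)) *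
        (-(x + N)) ^ j * hurwitzTerm x s N
      = (-1 : ℂ) ^ j * ((k + 1).choose j : ℂ) *
        bernoulliBarnes (k + 1 - j) x (consOnes a (k + 1)) * hurwitzTerm x (s - j) N := by
    intro j
    rw [← pow_mul_hurwitzTerm hx, neg_pow]
    ring
  simp_rw [h1]
  ring

theorem finite_fiber_consOnes {a : ℕ} (ha : a ≠ 0) (k N : ℕ) :
    Finite {m : Fin (k + 2) → ℕ // a * m 0 + ∑ i : Fin (k + 1), m i.succ = N} := by
  refine Set.Finite.to_subtype ((Set.Finite.pi' fun _ : Fin (k + 2) => Set.finite_Iic N).subset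
    fun m hm i => ?_)
  have hm' : a * m 0 + ∑ i : Fin (k + 1), m i.succ = N := hm
  refine Set.mem_Iic.2 ?_
  refine Fin.cases ?_ (fun i => ?_) i
  · have := Nat.le_mul_of_pos_left (m 0) (Nat.pos_of_ne_zero ha)
    omega
  · have := Finset.single_le_sum (f := fun i : Fin (k + 1) => m i.succ) (fun _ _ => Nat.zero_le _)
      (Finset.mem_univ i)
    omega

/-- The Barnes series for `(a, 1, …, 1)` converges and is a combination of Hurwitz series. -/
theorem summable_and_tsum_barnesTerm {a : ℕ} (ha : a ≠ 0) (k : ℕ) {x s : ℂ} (hx : 0 < x.re)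
    (hs : ((k + 1 + 1 : ℕ) : ℝ) < s.re) :
    Summable (barnesTerm (consOnes a (k + 1)) x s) ∧
      ∑' m, barnesTerm (consOnes a (k + 1)) x s m
        = barnesHurwitzSum (fun y w => ∑' m : ℕ, hurwitzTerm y w m) (k + 1) a x s := by
  have h := hasSum_card_fiber_mul_hurwitzTerm ha k hx hs
  have h2 := summable_and_tsum_comp_of_card_fiber
    (fun m : Fin (k + 2) → ℕ => a * m 0 + ∑ i : Fin (k + 1), m i.succ)
    (finite_fiber_consOnes ha k) (hurwitzTerm x s) h.summable
  have he : barnesTerm (consOnes a (k + 1)) x s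
      = fun m => hurwitzTerm x s (a * m 0 + ∑ i : Fin (k + 1), m i.succ) :=
    funext (barnesTerm_consOnes a k x s)
  rw [he]
  exact ⟨h2.1, h2.2.trans h.tsum_eq⟩

/-- The `k`-th shifted function can be singular only at `s = k + 1`, and the residue-class terms
only at `s = 1`, which is excluded by `k = 0`. -/
theorem analyticAt_barnesHurwitzSum {a : ℕ} (ha : a ≠ 0) (n : ℕ) {x s : ℂ} (hx : 0 < x.re)
    (hs : ∀ k ∈ Finset.range (n + 1), s ≠ (k : ℂ) + 1) :
    AnalyticAt ℂ (barnesHurwitzSum hurwitzZeta n a x) s := by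
  have ha' : (a : ℂ) ≠ 0 := Nat.cast_ne_zero.2 ha
  have hpow : AnalyticAt ℂ (fun s : ℂ => (a : ℂ) ^ (-s)) s := by
    have hd : Differentiable ℂ fun s : ℂ => (a : ℂ) ^ (-s) := fun s =>
      DifferentiableAt.const_cpow (by fun_prop) (Or.inl ha')
    exact (hd.differentiableOn (s := univ)).analyticAt univ_mem
  have h1 : s ≠ 1 := by simpa using hs 0 (by simp)
  refine (analyticAt_const.fun_mul (Finset.analyticAt_fun_sum _ fun k hk => ?_)).fun_add
    ((analyticAt_const.fun_mul hpow).fun_mul (Finset.analyticAt_fun_sum _ fun r hr => ?_))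
  · refine analyticAt_const.fun_mul (AnalyticAt.fun_comp (g := hurwitzZeta x)
      ((hurwitzZeta_spec hx).2 _ ?_) (by fun_prop : AnalyticAt ℂ (fun s : ℂ => s - k) s))
    exact fun h => hs k hk (by rw [← h]; ring)
  · exact analyticAt_const.fun_mul
      ((hurwitzZeta_spec (re_one_add_sub_div_pos ha (Finset.mem_Icc.1 hr).2 hx)).2 s h1)

theorem meromorphicOn_barnesHurwitzSum {a : ℕ} (ha : a ≠ 0) (n : ℕ) {x : ℂ} (hx : 0 < x.re) :
    MeromorphicOn (barnesHurwitzSum hurwitzZeta n a x) univ := by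
  intro s _
  have ha' : (a : ℂ) ≠ 0 := Nat.cast_ne_zero.2 ha
  have hpow : MeromorphicAt (fun s : ℂ => (a : ℂ) ^ (-s)) s := by
    have hd : Differentiable ℂ fun s : ℂ => (a : ℂ) ^ (-s) := fun s =>
      DifferentiableAt.const_cpow (by fun_prop) (Or.inl ha')
    exact ((hd.differentiableOn (s := univ)).analyticAt univ_mem).meromorphicAt
  have hz : ∀ y : ℂ, 0 < y.re → ∀ w, MeromorphicAt (hurwitzZeta y) w := fun y hy w =>
    ((hurwitzZeta_spec hy).1.1 (mem_univ w)).meromorphicAt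
  refine ((MeromorphicAt.const _ _).fun_mul (MeromorphicAt.fun_sum fun k hk => ?_)).fun_add
    (((MeromorphicAt.const _ _).fun_mul hpow).fun_mul (MeromorphicAt.fun_sum fun r hr => ?_))
  · exact (MeromorphicAt.const _ _).fun_mul (MeromorphicAt.comp_analyticAt
      (g := fun s : ℂ => s - k) (hz x hx (s - k)) (by fun_prop : AnalyticAt ℂ (fun s : ℂ => s - k) s))
  · exact (MeromorphicAt.const _ _).fun_mul
      (hz _ (re_one_add_sub_div_pos ha (Finset.mem_Icc.1 hr).2 hx) s)

end BarnesZeta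

end

/-! ### The main theorem -/

open BarnesZeta in
theorem mainTheorem9 (n : ℕ) (hn : 1 ≤ n) (a : ℕ) (ha : 1 ≤ a) (x : ℂ) (hx : 0 < x.re) :
    -- the Barnes series and the Hurwitz series converge absolutely, and their continuations exist
    ((∀ s : ℂ, ((n + 1 : ℕ) : ℝ) < s.re →
        Summable (BarnesZeta.barnesTerm (BarnesZeta.consOnes a n) x s)) ∧
      BarnesZeta.IsMeromorphicContinuation ((n + 1 : ℕ) : ℝ)
        (fun s => ∑' m : Fin (n + 1) → ℕ,
          BarnesZeta.barnesTerm (BarnesZeta.consOnes a n) x s m)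
        (BarnesZeta.barnesZeta (BarnesZeta.consOnes a n) x)) ∧
    (∀ y : ℂ, 0 < y.re →
      (∀ s : ℂ, 1 < s.re → Summable (BarnesZeta.hurwitzTerm y s)) ∧
      BarnesZeta.IsMeromorphicContinuation 1
        (fun s => ∑' m : ℕ, BarnesZeta.hurwitzTerm y s m) (BarnesZeta.hurwitzZeta y)) ∧
    -- the identity, away from the possible poles `1, 2, …, n + 1` of its terms
    ∀ s : ℂ, (∀ k ∈ Finset.range (n + 1), s ≠ (k : ℂ) + 1) →
      BarnesZeta.barnesZeta (BarnesZeta.consOnes a n) x s =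
        (-1 : ℂ) ^ n / (n.factorial : ℂ) *
            ∑ k ∈ Finset.range (n + 1),
              (-1 : ℂ) ^ k * (n.choose k : ℂ) *
                BarnesZeta.bernoulliBarnes (n - k) x (BarnesZeta.consOnes a n) *
                BarnesZeta.hurwitzZeta x (s - k) +
          (-1 : ℂ) ^ (n - 1) / (n.factorial : ℂ) * (a : ℂ) ^ (-s) *
            ∑ r ∈ Finset.Icc 1 a,
              BarnesZeta.bernoulliBarnes n (r : ℂ) (BarnesZeta.consOnes a n) *
                BarnesZeta.hurwitzZeta (1 + (x - r) / a) s := by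
  have ha0 : a ≠ 0 := by omega
  obtain ⟨k, rfl⟩ : ∃ k, n = k + 1 := ⟨n - 1, by omega⟩
  have hpole : ∀ s : ℂ, ((k + 1 + 1 : ℕ) : ℝ) < s.re →
      ∀ j ∈ Finset.range (k + 1 + 1), s ≠ (j : ℂ) + 1 := by
    rintro s hs j hj rfl
    have hj' : (j : ℝ) + 1 ≤ (k + 1 + 1 : ℕ) := by exact_mod_cast Finset.mem_range.1 hj
    simp only [Complex.add_re, Complex.natCast_re, Complex.one_re] at hs
    linarith
  have hmer := meromorphicOn_barnesHurwitzSum ha0 (k + 1) hx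
  -- The right-hand side, in normal form, is itself the witness for the continuation of the Barnes
  -- series.
  have hcont : IsMeromorphicContinuation ((k + 1 + 1 : ℕ) : ℝ)
      (fun s => ∑' m : Fin (k + 1 + 1) → ℕ, barnesTerm (consOnes a (k + 1)) x s m)
      (toMeromorphicNFOn (barnesHurwitzSum hurwitzZeta (k + 1) a x) Set.univ) := by
    refine isMeromorphicContinuation_toMeromorphicNFOn hmer
      (fun s hs => analyticAt_barnesHurwitzSum ha0 _ hx (hpole s hs)) fun s hs => ?_
    rw [(summable_and_tsum_barnesTerm ha0 k hx hs).2, barnesHurwitzSum, barnesHurwitzSum]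
    push_cast at hs
    congr 2
    · refine Finset.sum_congr rfl fun j hj => ?_
      have hj' : (j : ℝ) ≤ k + 1 := by
        exact_mod_cast Nat.lt_succ_iff.1 (Finset.mem_range.1 hj)
      rw [(hurwitzZeta_spec hx).1.2 _ (by
        rw [Complex.sub_re, Complex.natCast_re]
        linarith)]
    · refine Finset.sum_congr rfl fun r hr => ?_
      rw [(hurwitzZeta_spec (re_one_add_sub_div_pos ha0 (Finset.mem_Icc.1 hr).2 hx)).1.2 s
        (by linarith [(Nat.cast_nonneg k : (0 : ℝ) ≤ k)])]
  refine ⟨⟨fun s hs => (summable_and_tsum_barnesTerm ha0 k hx hs).1,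
    isMeromorphicContinuation_meromorphicContinuation hcont⟩,
    fun y hy => ⟨fun s hs => (summable_norm_hurwitzTerm hy hs).of_norm, (hurwitzZeta_spec hy).1⟩,
    fun s hs => ?_⟩
  -- Uniqueness identifies the two continuations; passing to normal form changes no value at a point
  -- of analyticity.
  rw [barnesZeta, meromorphicContinuation_eq hcont,
    toMeromorphicNFOn_univ_eq hmer (analyticAt_barnesHurwitzSum ha0 _ hx hs)]
  rfl
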